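/- All spaces are Tychonoff (completely regular and $T_1$). A topological space $X$ is called almost discrete if it has precisely one nonisolated point. Let $C_p(X)$ be the set of all continuous functions $X\to\mathbb{R}$ with the topology of pointwise convergence. A subset $A$ of a space $Y$ is countably compact in $Y$ if each sequence of points of $A$ has a limit (cluster) point in $Y$; $Y$ is a $g$-space if every subset $A$ of $Y$ that is countably compact in $Y$ has compact closure in $Y$; and $X$ is a Grothendieck space if $C_p(X)$ is a hereditary $g$-space, that is, every subspace of $C_p(X)$ is a $g$-space. The tightness $t(X)$ is the smallest infinite cardinal $\tau$ such that for every $A\subseteq X$ and every $x\in\overline{A}$ there is $B\subseteq A$ with $|B|\le\tau$ and $x\in\overline{B}$. Let $X$ be an almost discrete Tychonoff space. Then $X$ is a Grothendieck space if and only if $X$ is Lindelöf and $t(X)=\omega$. -/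

import Mathlib

open Filter Topology Cardinal

universe u

/-- A topological space is almost discrete if it has precisely one nonisolated point. -/
def IsAlmostDiscrete (X : Type u) [TopologicalSpace X] : Prop :=
  ∃! x : X, ¬ IsOpen ({x} : Set X)

/-- The space of continuous real-valued functions on `X` with the topology of pointwise
convergence, i.e. with the subspace topology inherited from the product `X → ℝ`. -/
abbrev Cp (X : Type u) [TopologicalSpace X] : Type u :=
  {f : X → ℝ // Continuous f}

/-- `A` is countably compact in the ambient space `Y` (relatively countably compact): each
sequence of points of `A` has a limit point (cluster point) in `Y`. -/
def IsCountablyCompactIn {Y : Type u} [TopologicalSpace Y] (A : Set Y) : Prop :=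
  ∀ s : ℕ → Y, (∀ n, s n ∈ A) → ∃ y : Y, MapClusterPt y atTop s

/-- A `g`-space: every subset that is countably compact in the space has compact closure. -/
def IsGSpace (Y : Type u) [TopologicalSpace Y] : Prop :=
  ∀ A : Set Y, IsCountablyCompactIn A → IsCompact (closure A)

/-- A hereditary `g`-space: every subspace, with its own topology, is a `g`-space. -/
def IsHereditaryGSpace (Y : Type u) [TopologicalSpace Y] : Prop :=
  ∀ S : Set Y, IsGSpace S

/-- `X` is a Grothendieck space if `Cp X` is a hereditary `g`-space. -/
def IsGrothendieckSpace (X : Type u) [TopologicalSpace X] : Prop :=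
  IsHereditaryGSpace (Cp X)

/-- The tightness of `X`: the smallest infinite cardinal `τ` such that every point `x` of the
closure of a set `A` lies in the closure of a subset of `A` of cardinality at most `τ`. -/
noncomputable def tightness (X : Type u) [TopologicalSpace X] : Cardinal.{u} :=
  sInf {τ : Cardinal.{u} | ℵ₀ ≤ τ ∧
    ∀ (A : Set X) (x : X), x ∈ closure A → ∃ B : Set X, B ⊆ A ∧ #B ≤ τ ∧ x ∈ closure B}

/-! Necessity: if all countable subsets of `E` are clopen, their indicators form a subspace of `Cp
X` in which every sequence clusters. It is then compact, hence closed in `X → ℝ`, and contains the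
limit `E.indicator 1`; so `E` is countable. Lindelöfness and countable tightness are two instances.
Sufficiency: let `A` be countably compact in a subspace `S`. Countable tightness makes every point
of its closure in `X → ℝ` continuous; Lindelöfness makes it the limit of a sequence from `A`, whose
cluster point in `S` must be that limit. So both closures agree, and the one in the product is
closed in a box of compact intervals. -/

/-- The inclusion of a subspace of `Cp X` into the product `X → ℝ` is an embedding. -/
theorem isEmbedding_coe_coe_Cp {X : Type u} [TopologicalSpace X] (S : Set (Cp X)) :
    IsEmbedding (fun f : S => f.1.1) :=
  IsEmbedding.subtypeVal.comp IsEmbedding.subtypeVal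

theorem Topology.IsInducing.mapClusterPt_comp_iff {Y Z α : Type*} [TopologicalSpace Y]
    [TopologicalSpace Z] {f : Y → Z} (hf : IsInducing f) {y : Y} {l : Filter α} {u : α → Y} :
    MapClusterPt (f y) l (f ∘ u) ↔ MapClusterPt y l u := by
  rw [MapClusterPt, ← Filter.map_map]
  exact hf.mapClusterPt_iff

/-! ### Necessity -/

/-- In a Grothendieck space, a set all of whose countable subsets are clopen is countable. -/
theorem IsGrothendieckSpace.countable_of_isClopen {X : Type u} [TopologicalSpace X]
    (h : IsGrothendieckSpace X) {E : Set X}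
    (hE : ∀ B ⊆ E, B.Countable → IsClopen B) : E.Countable := by
  classical
  let S : Set (Cp X) := {f | ∃ B ⊆ E, B.Countable ∧ f.1 = B.indicator 1}
  have hι := isEmbedding_coe_coe_Cp S
  have hmem : ∀ B ⊆ E, B.Countable → ∃ f : S, f.1.1 = B.indicator 1 := fun B hB hBc =>
    ⟨⟨⟨B.indicator 1, (continuous_one).indicator
      (by simp [(hE B hB hBc).frontier_eq])⟩, B, hB, hBc, rfl⟩, rfl⟩
  have hcc : IsCountablyCompactIn (Set.univ : Set S) := by
    intro s _
    choose B hBE hBc hB using fun n => (s n).2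
    have hK : IsCompact (Set.univ.pi fun _ : X => ({0, 1} : Set ℝ)) :=
      isCompact_univ_pi fun _ => (Set.toFinite _).isCompact
    obtain ⟨g, hgK, hg⟩ := hK.exists_mapClusterPt (f := atTop) (u := fun n => (s n).1.1) (by
      rw [le_principal_iff]
      refine Filter.mem_map.2 (Eventually.of_forall fun n x _ => ?_)
      change (s n).1.1 x ∈ _
      rw [hB n]
      by_cases hx : x ∈ B n <;> simp [hx])
    -- A cluster point vanishes off the countable union of the supports, so it is again the
    -- indicator of a countable subset of `E`.
    have hg0 : ∀ x, x ∉ ⋃ n, B n → g x = 0 := by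
      intro x hx
      have hcl : IsClosed {f : X → ℝ | f x = 0} :=
        isClosed_singleton.preimage (continuous_apply x)
      refine hcl.mem_of_mapClusterPt hg (Eventually.of_forall fun n => ?_)
      have : x ∉ B n := fun hn => hx (Set.mem_iUnion.2 ⟨n, hn⟩)
      simp [hB n, this]
    have hsub : {x | g x = 1} ⊆ ⋃ n, B n := by
      intro x hx
      by_contra hn
      have := hg0 x hn
      simp_all
    obtain ⟨f, hf⟩ := hmem {x | g x = 1} (hsub.trans (Set.iUnion_subset hBE))
      ((Set.countable_iUnion hBc).mono hsub)
    have hfg : f.1.1 = g := by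
      rw [hf]
      ext x
      rcases hgK x trivial with hx | hx
      · have : g x = 0 := hx
        simp [Set.indicator, this]
      · have : g x = 1 := hx
        simp [Set.indicator, this]
    refine ⟨f, hι.isInducing.mapClusterPt_comp_iff.1 ?_⟩
    change MapClusterPt f.1.1 atTop fun n => (s n).1.1
    rwa [hfg]
  have hcomp : IsCompact (Set.range fun f : S => f.1.1) := by
    have := h S Set.univ hcc
    rw [closure_univ] at this
    simpa using hι.isInducing.isCompact_iff.1 this
  have hlim : Tendsto (fun F : Finset X => (E ∩ ↑F).indicator (1 : X → ℝ)) atTop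
      (𝓝 (E.indicator 1)) := by
    rw [tendsto_pi_nhds]
    intro x
    refine tendsto_const_nhds.congr' ?_
    filter_upwards [eventually_ge_atTop ({x} : Finset X)] with F hF
    have hxF : x ∈ F := hF (by simp)
    simp [Set.indicator, hxF]
  obtain ⟨f, hf⟩ := hcomp.isClosed.mem_of_tendsto hlim (Eventually.of_forall fun F => by
    obtain ⟨f, hf⟩ := hmem (E ∩ ↑F) Set.inter_subset_left
      (F.countable_toSet.mono Set.inter_subset_right)
    exact ⟨f, hf⟩)
  obtain ⟨B, -, hBc, hB⟩ := f.2
  have hEB : E = B := by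
    have : E.indicator (1 : X → ℝ) = B.indicator 1 := hf.symm.trans hB
    ext x
    have := congrFun this x
    by_cases h1 : x ∈ E <;> by_cases h2 : x ∈ B <;> simp_all
  exact hEB ▸ hBc

theorem tightness_eq_aleph0_iff {X : Type u} [TopologicalSpace X] :
    tightness X = ℵ₀ ↔ ∀ (A : Set X) (x : X), x ∈ closure A →
      ∃ B ⊆ A, B.Countable ∧ x ∈ closure B := by
  have key : ∀ B : Set X, #B ≤ ℵ₀ ↔ B.Countable := fun B => Cardinal.le_aleph0_iff_set_countable
  constructor
  · intro h
    have hne : {τ : Cardinal.{u} | ℵ₀ ≤ τ ∧ ∀ (A : Set X) (x : X), x ∈ closure A →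
        ∃ B : Set X, B ⊆ A ∧ #B ≤ τ ∧ x ∈ closure B}.Nonempty :=
      ⟨max ℵ₀ #X, le_max_left _ _, fun A x hx =>
        ⟨A, subset_rfl, (Cardinal.mk_set_le A).trans (le_max_right _ _), hx⟩⟩
    have hm := csInf_mem hne
    change tightness X ∈ _ at hm
    rw [h] at hm
    intro A x hx
    obtain ⟨B, hBA, hB, hxB⟩ := hm.2 A x hx
    exact ⟨B, hBA, (key B).1 hB, hxB⟩
  · intro h
    refine le_antisymm (csInf_le' ⟨le_rfl, fun A x hx => ?_⟩) (le_csInf ⟨max ℵ₀ #X,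
      le_max_left _ _, fun A x hx =>
        ⟨A, subset_rfl, (Cardinal.mk_set_le A).trans (le_max_right _ _), hx⟩⟩ fun τ hτ => hτ.1)
    obtain ⟨B, hBA, hB, hxB⟩ := h A x hx
    exact ⟨B, hBA, (key B).2 hB, hxB⟩

/-- A set avoiding a neighbourhood of the only nonisolated point is clopen. -/
theorem isClopen_of_forall_isOpen_singleton {X : Type u} [TopologicalSpace X] {p : X}
    (hp : ∀ x, x ≠ p → IsOpen ({x} : Set X)) {B : Set X} (hB : p ∉ closure B) : IsClopen B := by
  have hopen : ∀ C : Set X, p ∉ C → IsOpen C := fun C hC => by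
    rw [← Set.biUnion_of_singleton C]
    exact isOpen_biUnion fun x hx => hp x fun hxp => hC (hxp ▸ hx)
  refine ⟨isClosed_of_closure_subset fun x hx => ?_, hopen B fun h => hB (subset_closure h)⟩
  have hxp : x ≠ p := fun h => hB (h ▸ hx)
  obtain ⟨y, rfl, hy⟩ := mem_closure_iff.1 hx _ (hp x hxp) rfl
  exact hy

/-- The complement of a cover member containing `p` is closed and misses `p`, so all its subsets are
clopen and it is countable. -/
theorem IsGrothendieckSpace.lindelofSpace {X : Type u} [TopologicalSpace X] {p : X}
    (h : IsGrothendieckSpace X) (hp : ∀ x, x ≠ p → IsOpen ({x} : Set X)) : LindelofSpace X := by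
  refine ⟨isLindelof_of_countable_subcover fun {ι} U hU hcov => ?_⟩
  obtain ⟨i, hi⟩ := Set.mem_iUnion.1 (hcov (Set.mem_univ p))
  have hc : (U i)ᶜ.Countable := h.countable_of_isClopen fun B hB _ =>
    isClopen_of_forall_isOpen_singleton hp fun hpB =>
      (closure_minimal hB (hU i).isClosed_compl) hpB hi
  choose j hj using fun x => Set.mem_iUnion.1 (hcov (Set.mem_univ x))
  refine ⟨insert i (j '' (U i)ᶜ), (hc.image j).insert i, fun x _ => ?_⟩
  by_cases hx : x ∈ U i
  · exact Set.mem_biUnion (Set.mem_insert _ _) hx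
  · exact Set.mem_biUnion (Set.mem_insert_of_mem _ ⟨x, hx, rfl⟩) (hj x)

theorem IsGrothendieckSpace.tightness_eq {X : Type u} [TopologicalSpace X] {p : X}
    (h : IsGrothendieckSpace X) (hp : ∀ x, x ≠ p → IsOpen ({x} : Set X)) :
    tightness X = ℵ₀ := by
  refine tightness_eq_aleph0_iff.2 fun A x hx => ?_
  by_cases hxp : x = p
  · subst hxp
    by_contra! hcon
    -- If no countable subset of `A` accumulates at the point, then `A` is itself countable, and
    -- `hcon` applies to `A`.
    exact hcon A subset_rfl (h.countable_of_isClopen fun B hB hBc =>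
      isClopen_of_forall_isOpen_singleton hp (hcon B hB hBc)) hx
  · obtain ⟨y, rfl, hy⟩ := mem_closure_iff.1 hx _ (hp x hxp) rfl
    exact ⟨{y}, by simpa using hy, Set.countable_singleton y, subset_closure rfl⟩

/-! ### Sufficiency -/

theorem exists_mem_forall_abs_sub_lt_of_mem_closure {X : Type u} {A : Set (X → ℝ)} {f : X → ℝ}
    (hf : f ∈ closure A) {F : Set X} (hF : F.Finite) {ε : ℝ} (hε : 0 < ε) :
    ∃ g ∈ A, ∀ x ∈ F, |g x - f x| < ε := by
  have ho : F.pi (fun x => Metric.ball (f x) ε) ∈ 𝓝 f :=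
    set_pi_mem_nhds hF fun x _ => Metric.ball_mem_nhds _ hε
  obtain ⟨g, hg, hgA⟩ := mem_closure_iff_nhds.1 hf _ ho
  exact ⟨g, hgA, fun x hx => by simpa [Real.dist_eq] using hg x hx⟩

/-- A point of the closure of `A` in the product is, on a countable set, the limit of a sequence
of points of `A`. -/
theorem exists_seq_tendsto_on_countable {X : Type u} {A : Set (X → ℝ)} {f : X → ℝ}
    (hf : f ∈ closure A) {C : Set X} (hC : C.Countable) :
    ∃ a : ℕ → X → ℝ, (∀ n, a n ∈ A) ∧ ∀ x ∈ C, Tendsto (fun n => a n x) atTop (𝓝 (f x)) := by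
  rcases C.eq_empty_or_nonempty with rfl | hne
  · obtain ⟨g, hg⟩ := closure_nonempty_iff.1 ⟨f, hf⟩
    exact ⟨fun _ => g, fun _ => hg, by simp⟩
  obtain ⟨e, rfl⟩ := hC.exists_eq_range hne
  choose a haA ha using fun n : ℕ => exists_mem_forall_abs_sub_lt_of_mem_closure hf
    ((Set.finite_Iic n).image e) (Nat.one_div_pos_of_nat (α := ℝ) (n := n))
  refine ⟨a, haA, ?_⟩
  rintro _ ⟨k, rfl⟩
  rw [tendsto_iff_dist_tendsto_zero]
  refine squeeze_zero' (Eventually.of_forall fun _ => dist_nonneg) ?_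
    (tendsto_one_div_add_atTop_nhds_zero_nat (𝕜 := ℝ))
  filter_upwards [eventually_ge_atTop k] with n hn
  exact (ha n _ ⟨k, hn, rfl⟩).le

/-- On a space with one nonisolated point and countable tightness, if every sequence in `A` has a
continuous cluster point, then every point of the closure of `A` is continuous. -/
theorem continuous_of_mem_closure {X : Type u} [TopologicalSpace X] {p : X}
    (hp : ∀ x, x ≠ p → IsOpen ({x} : Set X)) (ht : tightness X = ℵ₀) {A : Set (X → ℝ)}
    (hA : ∀ s : ℕ → X → ℝ, (∀ n, s n ∈ A) → ∃ g, Continuous g ∧ MapClusterPt g atTop s)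
    {f : X → ℝ} (hf : f ∈ closure A) : Continuous f := by
  rw [continuous_iff_continuousAt]
  intro x
  by_cases hx : x = p
  swap
  · rw [ContinuousAt, (isOpen_singleton_iff_nhds_eq_pure x).1 (hp x hx)]
    exact tendsto_pure_nhds f x
  subst hx
  rw [Metric.continuousAt_iff']
  intro ε hε
  by_contra hcon
  have hcl : x ∈ closure {y | ¬ dist (f y) (f x) < ε} := mem_closure_iff_frequently.2 (not_eventually.1 hcon)
  obtain ⟨B, hBA, hBc, hxB⟩ := tightness_eq_aleph0_iff.1 ht _ _ hcl
  -- `x` is inserted so that the continuous cluster point agrees with `f` at `x` as well as on `B`.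
  obtain ⟨a, haA, ha⟩ := exists_seq_tendsto_on_countable hf (hBc.insert x)
  obtain ⟨g, hgc, hg⟩ := hA a haA
  have hgf : ∀ y ∈ insert x B, g y = f y := by
    intro y hy
    have h1 : MapClusterPt (g y) atTop (fun n => a n y) :=
      hg.continuousAt_comp (continuous_apply y).continuousAt
    exact eq_of_nhds_neBot (ClusterPt.mono h1 (ha y hy))
  have hev := Metric.continuousAt_iff'.1 (hgc.continuousAt (x := x)) ε hε
  obtain ⟨y, hyB, hy⟩ := ((mem_closure_iff_frequently.1 hxB).and_eventually hev).exists
  rw [hgf y (Set.mem_insert_of_mem _ hyB), hgf x (Set.mem_insert _ _)] at hy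
  exact hBA hyB hy

/-- On a Lindelöf space with one nonisolated point, a continuous function is constant outside a
countable set. -/
theorem Continuous.countable_setOf_ne {X : Type u} [TopologicalSpace X] [LindelofSpace X] {p : X}
    (hp : ∀ x, x ≠ p → IsOpen ({x} : Set X)) {f : X → ℝ} (hf : Continuous f) :
    {x | f x ≠ f p}.Countable := by
  have h : {x | f x ≠ f p} = ⋃ n : ℕ, {x | 1 / ((n : ℝ) + 1) ≤ dist (f x) (f p)} := by
    ext x
    simp only [Set.mem_ofPred_eq, Set.mem_iUnion]
    constructor
    · intro hx
      obtain ⟨n, hn⟩ := exists_nat_one_div_lt (dist_pos.2 hx)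
      exact ⟨n, hn.le⟩
    · rintro ⟨n, hn⟩
      exact dist_pos.1 (Nat.one_div_pos_of_nat.trans_le hn)
  rw [h]
  refine Set.countable_iUnion fun n => ?_
  have hcl : IsClosed {x | 1 / ((n : ℝ) + 1) ≤ dist (f x) (f p)} :=
    isClosed_le continuous_const (hf.dist continuous_const)
  -- The set is closed and omits `p`, hence consists of isolated points.
  refine hcl.isLindelof.countable_of_isDiscrete ?_
  rw [isDiscrete_iff_forall_mem_exists_isOpen]
  intro x hx
  refine ⟨{x}, hp x ?_, by simpa using hx⟩
  rintro rfl
  have := Nat.one_div_pos_of_nat (α := ℝ) (n := n)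
  simp only [Set.mem_ofPred_eq, dist_self] at hx
  linarith

/-- On a Lindelöf space with one nonisolated point, a continuous function in the closure of a set
`A` of continuous functions is the limit of a sequence of points of `A`. -/
theorem exists_seq_tendsto_of_mem_closure {X : Type u} [TopologicalSpace X] [LindelofSpace X]
    {p : X} (hp : ∀ x, x ≠ p → IsOpen ({x} : Set X)) {A : Set (X → ℝ)}
    (hA : ∀ g ∈ A, Continuous g) {f : X → ℝ} (hf : f ∈ closure A) (hfc : Continuous f) :
    ∃ a : ℕ → X → ℝ, (∀ n, a n ∈ A) ∧ Tendsto a atTop (𝓝 f) := by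
  have henum : ∀ g : X → ℝ, ∃ e : ℕ → X, Continuous g → ∀ x, x ∉ Set.range e → g x = g p := by
    intro g
    by_cases hg : Continuous g
    · obtain ⟨e, he⟩ := ((Continuous.countable_setOf_ne hp hg).insert p).exists_eq_range
        (Set.insert_nonempty _ _)
      refine ⟨e, fun _ x hx => ?_⟩
      by_contra hne
      exact hx (he ▸ Set.mem_insert_of_mem _ hne)
    · exact ⟨fun _ => p, fun h => absurd h hg⟩
  choose e he using henum
  -- The index `q.1` sets both the precision and how much of each enumeration is controlled. `P`
  -- handles `p` and the points of `e f`; `r` handles the points enumerated for earlier functions.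
  let P : ℕ × (X → ℝ) → Prop := fun q => q.2 ∈ A ∧
    ∀ x ∈ insert p (e f '' Set.Iic q.1), |q.2 x - f x| < 1 / ((q.1 : ℝ) + 1)
  let r : ℕ × (X → ℝ) → ℕ × (X → ℝ) → Prop := fun q q' => q.1 < q'.1 ∧
    ∀ x ∈ e q.2 '' Set.Iic q'.1, |q'.2 x - f x| < 1 / ((q'.1 : ℝ) + 1)
  obtain ⟨q, hqP, hqr⟩ := exists_seq_of_forall_finset_exists P r (by
    intro s _
    let k := s.sup Prod.fst + 1
    obtain ⟨g, hgA, hg⟩ := exists_mem_forall_abs_sub_lt_of_mem_closure hf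
      ((((Set.finite_Iic k).image (e f)).insert p).union
        (s.finite_toSet.biUnion fun t _ => (Set.finite_Iic k).image (e t.2)))
      (Nat.one_div_pos_of_nat (α := ℝ) (n := k))
    refine ⟨(k, g), ⟨hgA, fun x hx => hg x (Or.inl hx)⟩, fun t ht =>
      ⟨Nat.lt_succ_of_le (Finset.le_sup (f := Prod.fst) ht), fun x hx =>
        hg x (Or.inr (Set.mem_biUnion (Finset.mem_coe.2 ht) hx))⟩⟩)
  have hmono : StrictMono fun n => (q n).1 := fun m n hmn => (hqr m n hmn).1
  have hzero : Tendsto (fun n => 1 / (((q n).1 : ℝ) + 1)) atTop (𝓝 0) :=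
    (tendsto_one_div_add_atTop_nhds_zero_nat (𝕜 := ℝ)).comp hmono.tendsto_atTop
  have hconv : ∀ x, (∀ᶠ n in atTop, |(q n).2 x - f x| < 1 / (((q n).1 : ℝ) + 1)) →
      Tendsto (fun n => (q n).2 x) atTop (𝓝 (f x)) := by
    intro x hx
    rw [tendsto_iff_dist_tendsto_zero]
    exact squeeze_zero' (Eventually.of_forall fun _ => dist_nonneg)
      (hx.mono fun n hn => hn.le) hzero
  refine ⟨fun n => (q n).2, fun n => (hqP n).1, tendsto_pi_nhds.2 fun x => ?_⟩
  by_cases hxf : x ∈ Set.range (e f)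
  · obtain ⟨j, rfl⟩ := hxf
    refine hconv _ ?_
    filter_upwards [hmono.tendsto_atTop.eventually_ge_atTop j] with n hn
    exact (hqP n).2 _ (Set.mem_insert_of_mem _ ⟨j, hn, rfl⟩)
  by_cases hxm : ∃ m, x ∈ Set.range (e (q m).2)
  · obtain ⟨m, j, rfl⟩ := hxm
    refine hconv _ ?_
    filter_upwards [hmono.tendsto_atTop.eventually_ge_atTop j, eventually_gt_atTop m]
      with n hn hmn
    exact (hqr m n hmn).2 _ ⟨j, hn, rfl⟩
  -- Off all the enumerations, `f` and every chosen function take their values at `p`.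
  · push Not at hxm
    have hlim := hconv p (Eventually.of_forall fun n => (hqP n).2 p (Set.mem_insert _ _))
    rw [he f hfc x hxf]
    exact hlim.congr fun n => (he _ (hA _ (hqP n).1) x (hxm n)).symm

/-- The image of a countably compact set under a continuous real function is bounded. -/
theorem IsCountablyCompactIn.exists_abs_le {Y : Type u} [TopologicalSpace Y] {A : Set Y}
    (hA : IsCountablyCompactIn A) {φ : Y → ℝ} (hφ : Continuous φ) :
    ∃ M, ∀ a ∈ A, |φ a| ≤ M := by
  by_contra! hcon
  choose s hsA hs using fun n : ℕ => hcon n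
  obtain ⟨y, hy⟩ := hA s hsA
  have h1 : MapClusterPt |φ y| atTop (fun n => |φ (s n)|) :=
    hy.continuousAt_comp (f := fun y => |φ y|) hφ.abs.continuousAt
  have h2 : ∃ᶠ n in atTop, |φ (s n)| < |φ y| + 1 := h1.frequently (Iio_mem_nhds (lt_add_one _))
  obtain ⟨N, hN⟩ := exists_nat_gt (|φ y| + 1)
  obtain ⟨n, hn, hNn⟩ := (h2.and_eventually (eventually_ge_atTop N)).exists
  have h3 := hs n
  have h4 : (N : ℝ) ≤ n := by exact_mod_cast hNn
  linarith

theorem isGrothendieckSpace_of_lindelofSpace {X : Type u} [TopologicalSpace X] [LindelofSpace X]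
    {p : X} (hp : ∀ x, x ≠ p → IsOpen ({x} : Set X)) (ht : tightness X = ℵ₀) :
    IsGrothendieckSpace X := by
  intro S A hA
  have hι := isEmbedding_coe_coe_Cp S
  let ι : S → X → ℝ := fun f => f.1.1
  change IsEmbedding ι at hι
  have hcont : ∀ f ∈ closure (ι '' A), Continuous f := fun f hf => by
    refine continuous_of_mem_closure hp ht (fun s hs => ?_) hf
    choose b hbA hb using hs
    obtain ⟨y, hy⟩ := hA b hbA
    refine ⟨ι y, y.1.2, ?_⟩
    have := hι.isInducing.mapClusterPt_comp_iff.2 hy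
    rwa [show ι ∘ b = s from funext hb] at this
  have hclosure : ι '' closure A = closure (ι '' A) := by
    refine (image_closure_subset_closure_image hι.continuous).antisymm fun f hf => ?_
    obtain ⟨a, haA, ha⟩ := exists_seq_tendsto_of_mem_closure hp
      (fun g hg => hcont g (subset_closure hg)) hf (hcont f hf)
    choose b hbA hb using haA
    obtain ⟨y, hy⟩ := hA b hbA
    have hy' := hι.isInducing.mapClusterPt_comp_iff.2 hy
    rw [show ι ∘ b = a from funext hb] at hy'
    have hyf : ι y = f := eq_of_nhds_neBot (ClusterPt.mono hy' ha)
    refine ⟨y, ?_, hyf⟩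
    rw [hι.isInducing.closure_eq_preimage_closure_image]
    rwa [Set.mem_preimage, hyf]
  rw [hι.isInducing.isCompact_iff, hclosure]
  choose M hM using fun x : X =>
    hA.exists_abs_le (φ := fun f => ι f x) ((continuous_apply x).comp hι.continuous)
  have hK : IsCompact (Set.univ.pi fun x => Set.Icc (-M x) (M x)) :=
    isCompact_univ_pi fun x => isCompact_Icc
  refine hK.of_isClosed_subset isClosed_closure (closure_minimal ?_ hK.isClosed)
  rintro _ ⟨f, hf, rfl⟩ x _
  exact abs_le.1 (hM x f hf)

theorem corollary3p7 {X : Type u} [TopologicalSpace X] [T35Space X] (hX : IsAlmostDiscrete X) :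
    IsGrothendieckSpace X ↔ (LindelofSpace X ∧ tightness X = ℵ₀) := by
  obtain ⟨p, -, hp⟩ := hX
  have hp' : ∀ x, x ≠ p → IsOpen ({x} : Set X) := fun x hx => by
    by_contra hn
    exact hx (hp x hn)
  exact ⟨fun h => ⟨h.lindelofSpace hp', h.tightness_eq hp'⟩,
    fun ⟨_, ht⟩ => isGrothendieckSpace_of_lindelofSpace hp' ht⟩
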